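/- Call a vector $x\in\mathbf R^n$ positive if all $x_i\ge 0$ and at least one $x_i>0$. Say that random points $z_1,\dots,z_n$ of $\mathbf R^d$ are admissible if they are independent (not necessarily identically distributed) and each has a probability density $f$ with $f(-z)=f(z)$. For $n\ge 1$ and $d\ge 0$ let $p(n,d)$ be the probability that the convex hull of $n$ admissible random points in $\mathbf R^d$ does not contain the origin. Let $n\ge 1$ and let $v_1,\dots,v_n$ be the rows of a random $n\times n$ matrix whose columns are admissible random points of $\mathbf R^n$. (For example, all entries are independent with even densities; then $v_1,\dots,v_n$ are independent random vectors.) Let $V_m$ be the span of $v_1,\dots,v_m$, with $V_0=\{0\}$. Then: 1. For each $d \ge 0$ the probability $p(n,d)$ is the same for every choice of admissible points, so that it is well defined. 2. For every $1\le m\le n$, the probability that $V_m$ contains a positive vector while $V_{m-1}$ does not is $$p(n,m)-p(n,m-1)=\frac{1}{2^{n-1}}\binom{n-1}{m-1}.$$ 3. Almost surely some $V_m$ with $m\le n$ contains a positive vector, and the least such $m$ is distributed as $1+B$, where $B$ has the binomial distribution with parameters $n-1$ and $1/2$ (the number of heads in $n-1$ tosses of a fair coin). -/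

import Mathlib

open MeasureTheory ProbabilityTheory

/-- A positive vector: all coordinates are nonnegative and at least one is positive. -/
def IsPositiveVector {n : ℕ} (x : Fin n → ℝ) : Prop :=
  (∀ i, 0 ≤ x i) ∧ ∃ i, 0 < x i

/-- The random vector `X` in `ℝ^d` has a density with respect to Lebesgue measure that is
symmetric with respect to the origin. -/
def HasSymmetricDensity {Ω : Type*} [MeasurableSpace Ω] (P : Measure Ω) {d : ℕ}
    (X : Ω → Fin d → ℝ) : Prop :=
  Measurable X ∧ ∃ f : (Fin d → ℝ) → ENNReal, Measurable f ∧ (∀ x, f (-x) = f x) ∧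
    P.map X = (volume : Measure (Fin d → ℝ)).withDensity f

/-- `z_1, …, z_n` are independent random points of `ℝ^d`, not necessarily identically distributed,
each having a density symmetric with respect to the origin. -/
structure IndepSymmetricPoints {Ω : Type*} [MeasurableSpace Ω] (P : Measure Ω) {n d : ℕ}
    (z : Fin n → Ω → Fin d → ℝ) : Prop where
  indep : iIndepFun z P
  density : ∀ j, HasSymmetricDensity P (z j)

/-- The event that the convex hull of the points `z_1, …, z_n` does not contain the origin. -/
def hullMissesOrigin {Ω : Type*} {n d : ℕ} (z : Fin n → Ω → Fin d → ℝ) : Set Ω :=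
  {ω | (0 : Fin d → ℝ) ∉ convexHull ℝ (Set.range fun j => z j ω)}

/-- The probability `p(n, d)` that the convex hull of `n` random points in `ℝ^d` does not contain
the origin, with independent standard Gaussian points for definiteness. -/
noncomputable def hullMissProb (n d : ℕ) : ℝ :=
  (Measure.pi fun _ : Fin n => Measure.pi fun _ : Fin d => gaussianReal 0 1).real
    (hullMissesOrigin fun (j : Fin n) (x : Fin n → Fin d → ℝ) => x j)

/-- `V_m`, the span of the first `m` of the random vectors `v_1, …, v_n`. -/
def firstSpan {Ω : Type*} {n : ℕ} (v : Fin n → Ω → Fin n → ℝ) (m : ℕ) (ω : Ω) :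
    Submodule ℝ (Fin n → ℝ) :=
  Submodule.span ℝ {x | ∃ i : Fin n, (i : ℕ) < m ∧ x = v i ω}

/-- The subspace `V` contains a positive vector. -/
def ContainsPositive {n : ℕ} (V : Submodule ℝ (Fin n → ℝ)) : Prop :=
  ∃ x ∈ V, IsPositiveVector x

/-- The least `m` such that `V_m` contains a positive vector. -/
noncomputable def firstPositiveIndex {Ω : Type*} {n : ℕ} (v : Fin n → Ω → Fin n → ℝ) (ω : Ω) : ℕ :=
  sInf {m | ContainsPositive (firstSpan v m ω)}

/-- The success probability `1/2` of a fair coin. -/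
noncomputable def fairCoin : unitInterval := ⟨1 / 2, by norm_num, by norm_num⟩

/-!
Wendel's theorem and the first span of random rows to contain a positive vector.

Points `z_1, …, z_n` of `ℝ^d` have a convex hull missing the origin exactly when they lie in an open
half-space `{x | 0 < ⟨x, a⟩}` (`zero_notMem_convexHull_iff`). Fix points in general position and
reflect an arbitrary subset of them in the origin. The number of the `2 ^ n` choices of reflections
that lead into an open half-space is the number of sign patterns `(sign ⟨z_j, a⟩)_j` realised by
some `a`, that is, the number of cells cut out by the `n` hyperplanes `z_j^⊥`. Adding a hyperplane
`H` splits exactly those cells that meet `H`, and these are counted by the arrangement induced in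
`H`, so the count `cellCount n d` depends on `n` and `d` only (`card_realizesSigns`). For
independent symmetric points all `2 ^ n` choices are equally likely to succeed, hence
`p(n, d) = cellCount n d / 2 ^ n` (`measureReal_inOpenHalfSpace`), whose increments in `d` are
binomial (`cellCount_succ_succ`). The points are almost surely in general position because each
new point avoids the span of fewer than `d` others (`ae_inGeneralPosition`).

For a random matrix with rows `v_i`, a linear combination `∑ i < m, a_i v_i` has as coordinates the
scalar products of `a` with the columns truncated to `ℝ^m`. In general position a nonzero
nonnegative vector of such scalar products can be perturbed to a strictly positive one, so `V_m`
contains a positive vector exactly when the truncated columns lie in an open half-space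
(`containsPositive_firstSpan_iff`). The truncated columns are again independent, symmetric and
without mass on proper subspaces, which is all that Wendel's theorem uses, so this event has
probability `p(n, m)`. As `V_m` increases with `m` and `p(n, n) = 1`, the distribution of the first
index follows by taking differences.
-/

/-! ### Counting sign patterns of linear functionals -/

/-- The sign `+1` or `-1` encoded by a Boolean. -/
def boolSign (b : Bool) : ℝ := if b then 1 else -1

@[simp] lemma boolSign_true : boolSign true = 1 := by simp [boolSign]

@[simp] lemma boolSign_false : boolSign false = -1 := by simp [boolSign]

lemma boolSign_ne_zero (b : Bool) : boolSign b ≠ 0 := by cases b <;> simp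

/-- The number of open cells into which `n` hyperplanes through the origin in general position
divide a `d`-dimensional space, defined by recursion. The value for `n > 0` and `d = 0` is zero,
because a functional on the zero space has no strict sign anywhere. -/
def cellCount : ℕ → ℕ → ℕ
  | 0, _ => 1
  | _ + 1, 0 => 0
  | n + 1, d + 1 => cellCount n (d + 1) + cellCount n d

lemma cellCount_succ_zero (n : ℕ) : cellCount (n + 1) 0 = 0 := rfl

/-- Increments of the Schläfli numbers: `cellCount (n + 1) d = 2 * ∑ k < d, n.choose k`. -/
lemma cellCount_succ_succ (n d : ℕ) :
    cellCount (n + 1) (d + 1) = cellCount (n + 1) d + 2 * n.choose d := by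
  induction n generalizing d with
  | zero => cases d <;> simp [cellCount]
  | succ n ih =>
    cases d with
    | zero =>
      have := ih 0
      simp only [cellCount, Nat.choose_zero_right] at this ⊢
      omega
    | succ d =>
      have h1 := ih d
      have h2 := ih (d + 1)
      change cellCount (n + 1) (d + 1 + 1) + cellCount (n + 1) (d + 1)
        = cellCount (n + 1) (d + 1) + cellCount (n + 1) d + _
      simp only [Nat.choose_succ_succ, Nat.succ_eq_add_one] at h2 ⊢
      omega

lemma cellCount_eq_sum (n d : ℕ) :
    cellCount (n + 1) d = 2 * ∑ k ∈ Finset.range d, n.choose k := by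
  induction d with
  | zero => simp [cellCount_succ_zero]
  | succ d ih => rw [cellCount_succ_succ, ih, Finset.sum_range_succ]; ring

lemma cellCount_self (n : ℕ) : cellCount (n + 1) (n + 1) = 2 ^ (n + 1) := by
  rw [cellCount_eq_sum, Nat.sum_range_choose]; ring

section SignPatterns

variable {E : Type*} [AddCommGroup E] [Module ℝ E]

/-- The sign pattern `ε` is realised by the functionals `f` at some point of `W`. -/
def RealizesSigns {n : ℕ} (W : Submodule ℝ E) (f : Fin n → Module.Dual ℝ E) (ε : Fin n → Bool) :
    Prop :=
  ∃ a ∈ W, ∀ j, 0 < boolSign (ε j) * f j a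

/-- The kernels of the functionals `f` meet `W` in subspaces of the expected dimension; by truncated
subtraction this is zero for more kernels than the dimension of `W`. -/
def KernelsInGeneralPosition {n : ℕ} (W : Submodule ℝ E) (f : Fin n → Module.Dual ℝ E) : Prop :=
  ∀ S : Finset (Fin n),
    Module.finrank ℝ ↥(W ⊓ ⨅ j ∈ S, LinearMap.ker (f j)) = Module.finrank ℝ W - S.card

lemma exists_pos_forall_pos_add_mul {ι : Type*} [Finite ι] (p q : ι → ℝ) (hp : ∀ j, 0 < p j) :
    ∃ t : ℝ, 0 < t ∧ ∀ j, 0 < p j + t * q j := by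
  have h : ∀ᶠ t in nhdsWithin (0 : ℝ) (Set.Ioi 0), ∀ j, 0 < p j + t * q j := by
    refine Filter.eventually_all.2 fun j => nhdsWithin_le_nhds ?_
    have hc : Continuous fun t : ℝ => p j + t * q j := by fun_prop
    exact (hc.tendsto 0).eventually (lt_mem_nhds (by simpa using hp j))
  obtain ⟨t, h1, h2⟩ := (h.and self_mem_nhdsWithin).exists
  exact ⟨t, h2, h1⟩

lemma KernelsInGeneralPosition.tail {n : ℕ} {W : Submodule ℝ E}
    {f : Fin (n + 1) → Module.Dual ℝ E} (h : KernelsInGeneralPosition W f) :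
    KernelsInGeneralPosition W (Fin.tail f) := by
  intro S
  have := h (S.map (Fin.succEmb n))
  rwa [← Finset.inf_eq_iInf, Finset.inf_map, Finset.inf_eq_iInf, Finset.card_map] at this

lemma KernelsInGeneralPosition.tail_inf_ker {n : ℕ} {W : Submodule ℝ E}
    {f : Fin (n + 1) → Module.Dual ℝ E} (h : KernelsInGeneralPosition W f) :
    KernelsInGeneralPosition (W ⊓ LinearMap.ker (f 0)) (Fin.tail f) := by
  intro S
  have h1 := h (insert 0 (S.map (Fin.succEmb n)))
  have h0 := h {0}
  rw [Finset.iInf_insert, Finset.card_insert_of_notMem (by simp), ← Finset.inf_eq_iInf,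
    Finset.inf_map, Finset.inf_eq_iInf, Finset.card_map] at h1
  rw [Finset.iInf_singleton, Finset.card_singleton] at h0
  rw [h0, inf_assoc, Nat.sub_sub, Nat.add_comm 1]
  exact h1

lemma KernelsInGeneralPosition.finrank_inf_ker {n : ℕ} {W : Submodule ℝ E}
    {f : Fin (n + 1) → Module.Dual ℝ E} (h : KernelsInGeneralPosition W f) :
    Module.finrank ℝ ↥(W ⊓ LinearMap.ker (f 0)) = Module.finrank ℝ W - 1 := by
  have h0 := h {0}
  rwa [Finset.iInf_singleton, Finset.card_singleton] at h0

/-- If a cell of the functionals other than `f 0` meets the kernel of `f 0`, and `f 0` does not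
vanish on `W`, then `f 0` takes both signs on the cell: move slightly off the kernel. -/
lemma RealizesSigns.cons_of_inf_ker {n : ℕ} {W : Submodule ℝ E} {f : Fin (n + 1) → Module.Dual ℝ E}
    {ε : Fin n → Bool} (h : RealizesSigns (W ⊓ LinearMap.ker (f 0)) (Fin.tail f) ε)
    {w : E} (hw : w ∈ W) (hfw : f 0 w ≠ 0) (b : Bool) :
    RealizesSigns W f (Fin.cons b ε) := by
  obtain ⟨a, ⟨haW, hak⟩, ha⟩ := h
  obtain ⟨u, hu, hfu⟩ : ∃ u ∈ W, 0 < boolSign b * f 0 u := by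
    rcases lt_or_gt_of_ne (mul_ne_zero (boolSign_ne_zero b) hfw) with h | h
    · exact ⟨-w, W.neg_mem hw, by simpa using h⟩
    · exact ⟨w, hw, h⟩
  obtain ⟨t, ht, hpos⟩ := exists_pos_forall_pos_add_mul
    (fun j => boolSign (ε j) * Fin.tail f j a) (fun j => boolSign (ε j) * Fin.tail f j u) ha
  refine ⟨a + t • u, W.add_mem haW (W.smul_mem t hu), Fin.cases ?_ fun j => ?_⟩
  · have hak' : f 0 a = 0 := hak
    simp only [Fin.cons_zero, map_add, map_smul, hak', zero_add, smul_eq_mul]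
    nlinarith [mul_pos ht hfu]
  · have := hpos j
    simp only [Fin.tail] at this
    simp only [Fin.cons_succ, map_add, map_smul, smul_eq_mul]
    linarith

/-- A cell of the functionals other than `f 0` meets the kernel of `f 0` exactly when both
extensions of its sign pattern are realised: the segment between two points where `f 0` has opposite
signs crosses the kernel. -/
lemma realizesSigns_inf_ker_iff {n : ℕ} {W : Submodule ℝ E} {f : Fin (n + 1) → Module.Dual ℝ E}
    {w : E} (hw : w ∈ W) (hfw : f 0 w ≠ 0) (ε : Fin n → Bool) :
    RealizesSigns (W ⊓ LinearMap.ker (f 0)) (Fin.tail f) ε ↔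
      RealizesSigns W f (Fin.cons true ε) ∧ RealizesSigns W f (Fin.cons false ε) := by
  refine ⟨fun h => ⟨h.cons_of_inf_ker hw hfw _, h.cons_of_inf_ker hw hfw _⟩, ?_⟩
  rintro ⟨⟨a, ha, hpa⟩, ⟨b, hb, hpb⟩⟩
  have ha0 := hpa 0
  have hb0 := hpb 0
  simp only [Fin.cons_zero, boolSign_true, boolSign_false, one_mul, neg_mul] at ha0 hb0
  refine ⟨(-f 0 b) • a + f 0 a • b, ⟨W.add_mem (W.smul_mem _ ha) (W.smul_mem _ hb), ?_⟩,
    fun j => ?_⟩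
  · simp only [SetLike.mem_coe, LinearMap.mem_ker, map_add, map_smul, smul_eq_mul]; ring
  · have h1 := mul_pos hb0 (hpa j.succ)
    have h2 := mul_pos ha0 (hpb j.succ)
    simp only [Fin.cons_succ] at h1 h2
    simp only [Fin.tail, map_add, map_smul, smul_eq_mul]
    linarith

lemma realizesSigns_tail_iff {n : ℕ} {W : Submodule ℝ E} {f : Fin (n + 1) → Module.Dual ℝ E}
    {w : E} (hw : w ∈ W) (hfw : f 0 w ≠ 0) (ε : Fin n → Bool) :
    RealizesSigns W (Fin.tail f) ε ↔
      RealizesSigns W f (Fin.cons true ε) ∨ RealizesSigns W f (Fin.cons false ε) := by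
  constructor
  · rintro ⟨a, ha, hpa⟩
    rcases lt_trichotomy (f 0 a) 0 with h | h | h
    · exact Or.inr ⟨a, ha, Fin.cases (by simpa using h) fun j => by simpa [Fin.tail] using hpa j⟩
    · exact Or.inl (RealizesSigns.cons_of_inf_ker ⟨a, ⟨ha, h⟩, hpa⟩ hw hfw _)
    · exact Or.inl ⟨a, ha, Fin.cases (by simpa using h) fun j => by simpa [Fin.tail] using hpa j⟩
  · rintro (⟨a, ha, hpa⟩ | ⟨a, ha, hpa⟩) <;>
      exact ⟨a, ha, fun j => by simpa [Fin.tail] using hpa j.succ⟩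

open Classical in
/-- The theorem of Schläfli: functionals in general position realise exactly
`cellCount n (dim W)` sign patterns. -/
theorem card_realizesSigns [FiniteDimensional ℝ E] {n : ℕ} {W : Submodule ℝ E}
    {f : Fin n → Module.Dual ℝ E}
    (h : KernelsInGeneralPosition W f) :
    (Finset.univ.filter fun ε => RealizesSigns W f ε).card
      = cellCount n (Module.finrank ℝ W) := by
  induction n generalizing W with
  | zero =>
    have : ∀ ε, RealizesSigns W f ε := fun ε => ⟨0, W.zero_mem, fun j => j.elim0⟩
    simp [this, cellCount]
  | succ n ih =>
    rcases hd : Module.finrank ℝ W with _ | d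
    · rw [cellCount_succ_zero, Finset.card_eq_zero, Finset.filter_eq_empty_iff]
      rintro ε - ⟨a, ha, hpa⟩
      have h0 := hpa 0
      rw [Submodule.finrank_eq_zero.1 hd, Submodule.mem_bot] at ha
      simp [ha] at h0
    · -- in general position the kernel of `f 0` meets `W` in a subspace of smaller dimension
      obtain ⟨w, hw, hfw⟩ : ∃ w ∈ W, f 0 w ≠ 0 := by
        by_contra! hall
        have h0 := h.finrank_inf_ker
        rw [inf_eq_left.2 fun x hx => hall x hx] at h0
        omega
      have key : (Finset.univ.filter fun ε => RealizesSigns W f ε).card =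
          (Finset.univ.filter fun ε => RealizesSigns W f (Fin.cons true ε)).card +
          (Finset.univ.filter fun ε => RealizesSigns W f (Fin.cons false ε)).card := by
        simp only [Finset.card_filter]
        rw [← (Fin.consEquiv fun _ => Bool).sum_comp, Fintype.sum_prod_type, Fintype.sum_bool]
        rfl
      -- patterns with at least one realised extension come from cells of `W`, those with both from
      -- cells of the kernel
      rw [key, ← Finset.card_union_add_card_inter, ← Finset.filter_or, ← Finset.filter_and]
      simp only [← realizesSigns_inf_ker_iff hw hfw, ← realizesSigns_tail_iff hw hfw]
      rw [ih h.tail, ih h.tail_inf_ker, h.finrank_inf_ker, hd]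
      rfl

end SignPatterns

/-! ### Points in general position and positive vectors -/

/-- Any selection of at most `d` of the points `z` of `ℝ^d` is linearly independent. -/
def InGeneralPosition {n d : ℕ} (z : Fin n → Fin d → ℝ) : Prop :=
  ∀ S : Finset (Fin n), S.card ≤ d → LinearIndependent ℝ fun j : S => z j

/-- The points `z` lie in an open half-space bounded by a hyperplane through the origin. -/
def InOpenHalfSpace {n d : ℕ} (z : Fin n → Fin d → ℝ) : Prop :=
  ∃ a : Fin d → ℝ, ∀ j, 0 < z j ⬝ᵥ a

/-- The functional `a ↦ ⟨w, a⟩`. -/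
def dotFunctional {d : ℕ} (w : Fin d → ℝ) : Module.Dual ℝ (Fin d → ℝ) :=
  dotProductBilin ℝ ℝ w

@[simp] lemma dotFunctional_apply {d : ℕ} (w a : Fin d → ℝ) : dotFunctional w a = w ⬝ᵥ a := rfl

lemma isOpen_inOpenHalfSpace (n d : ℕ) :
    IsOpen {z : Fin n → Fin d → ℝ | InOpenHalfSpace z} := by
  have : {z : Fin n → Fin d → ℝ | InOpenHalfSpace z} =
      ⋃ a : Fin d → ℝ, ⋂ j, {z | 0 < z j ⬝ᵥ a} := by
    ext z; simp [InOpenHalfSpace]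
  rw [this]
  refine isOpen_iUnion fun a => isOpen_iInter_of_finite fun j => ?_
  exact isOpen_lt continuous_const (by simp only [dotProduct]; fun_prop)

lemma zero_notMem_convexHull_iff {n d : ℕ} (z : Fin n → Fin d → ℝ) :
    (0 : Fin d → ℝ) ∉ convexHull ℝ (Set.range z) ↔ InOpenHalfSpace z := by
  constructor
  · intro h
    obtain ⟨f, u, h0, hu⟩ := geometric_hahn_banach_point_closed (convex_convexHull ℝ (Set.range z))
      ((Set.finite_range z).isClosed_convexHull ℝ) h
    refine ⟨fun i => f (Pi.single i 1), fun j => ?_⟩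
    have hj := hu (z j) (subset_convexHull ℝ _ ⟨j, rfl⟩)
    rw [map_zero] at h0
    have : f (z j) = z j ⬝ᵥ fun i => f (Pi.single i 1) := by
      have := LinearMap.pi_apply_eq_sum_univ (f : (Fin d → ℝ) →ₗ[ℝ] ℝ) (z j)
      simp only [ContinuousLinearMap.coe_coe, smul_eq_mul] at this
      rw [this]
      refine Finset.sum_congr rfl fun i _ => ?_
      congr 2
      ext k
      simp [Pi.single_apply, eq_comm]
    linarith
  · rintro ⟨a, ha⟩ h
    have hc : Convex ℝ {x : Fin d → ℝ | 0 < x ⬝ᵥ a} :=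
      convex_halfSpace_gt ⟨fun x y => add_dotProduct x y a, fun c x => smul_dotProduct c x a⟩ 0
    have := convexHull_min (s := Set.range z) (Set.range_subset_iff.2 ha) hc h
    simp at this

lemma finrank_iInf_ker_of_linearIndependent {n d : ℕ} {z : Fin n → Fin d → ℝ}
    {S : Finset (Fin n)} (h : LinearIndependent ℝ fun j : S => z j) :
    Module.finrank ℝ ↥(⨅ j ∈ S, LinearMap.ker (dotFunctional (z j))) = d - S.card := by
  let M : Matrix S (Fin d) ℝ := Matrix.of fun j => z j
  have hr : M.rank = S.card := by simpa using h.rank_matrix (M := M)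
  have hk : LinearMap.ker M.mulVecLin = ⨅ j ∈ S, LinearMap.ker (dotFunctional (z j)) := by
    ext a
    simp [M, Submodule.mem_iInf, funext_iff, Matrix.mulVec]
  have := M.mulVecLin.finrank_range_add_finrank_ker
  rw [← Matrix.rank, hr, hk, Module.finrank_fin_fun] at this
  omega

namespace InGeneralPosition

lemma eq_zero_of_dotProduct_eq_zero {n d : ℕ} {z : Fin n → Fin d → ℝ} (h : InGeneralPosition z)
    {S : Finset (Fin n)} (hS : d ≤ S.card) {a : Fin d → ℝ} (ha : ∀ j ∈ S, z j ⬝ᵥ a = 0) :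
    a = 0 := by
  obtain ⟨T, hTS, hT⟩ := Finset.exists_subset_card_eq hS
  have h1 := finrank_iInf_ker_of_linearIndependent (h T hT.le)
  rw [hT, Nat.sub_self, Submodule.finrank_eq_zero] at h1
  rw [← Submodule.mem_bot ℝ, ← h1]
  simpa [Submodule.mem_iInf] using fun j hj => ha j (hTS hj)

lemma kernels {n d : ℕ} {z : Fin n → Fin d → ℝ} (h : InGeneralPosition z) :
    KernelsInGeneralPosition ⊤ fun j => dotFunctional (z j) := by
  intro S
  rw [top_inf_eq, finrank_top, Module.finrank_fin_fun]
  rcases le_total S.card d with hS | hS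
  · exact finrank_iInf_ker_of_linearIndependent (h S hS)
  · rw [Nat.sub_eq_zero_of_le hS, Submodule.finrank_eq_zero, eq_bot_iff]
    intro a ha
    rw [Submodule.mem_bot]
    exact h.eq_zero_of_dotProduct_eq_zero hS (by simpa [Submodule.mem_iInf] using ha)

open Classical in
/-- Schläfli's count, in terms of reflections of the points in the origin. -/
lemma card_inOpenHalfSpace {n d : ℕ} {z : Fin n → Fin d → ℝ} (h : InGeneralPosition z) :
    (Finset.univ.filter fun ε : Fin n → Bool =>
      InOpenHalfSpace fun j => boolSign (ε j) • z j).card = cellCount n d := by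
  have := card_realizesSigns h.kernels
  rw [finrank_top, Module.finrank_fin_fun] at this
  simpa [RealizesSigns, InOpenHalfSpace] using this

/-- For points in general position a closed half-space, not bounded by a hyperplane through all the
points, can be tilted to an open one: fewer than `d` of the points lie on the bounding hyperplane,
so they are linearly independent and some `b` has scalar product `1` with each of them. -/
lemma inOpenHalfSpace_of_nonneg {n d : ℕ} {z : Fin n → Fin d → ℝ} (h : InGeneralPosition z)
    {a : Fin d → ℝ} (ha : ∀ j, 0 ≤ z j ⬝ᵥ a) (hpos : ∃ j, 0 < z j ⬝ᵥ a) : InOpenHalfSpace z := by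
  classical
  set T : Finset (Fin n) := Finset.univ.filter fun j => z j ⬝ᵥ a = 0 with hT
  -- `a ≠ 0` annihilates the points indexed by `T`, so there are fewer than `d` of them
  have hTd : T.card < d := by
    by_contra! hd
    obtain ⟨j, hj⟩ := hpos
    rw [h.eq_zero_of_dotProduct_eq_zero hd (a := a) (by simp [hT])] at hj
    simp at hj
  let M : Matrix T (Fin d) ℝ := Matrix.of fun j => z j
  have hr : M.rank = Fintype.card T := (h T hTd.le).rank_matrix (M := M)
  have hsurj : LinearMap.range M.mulVecLin = ⊤ := by
    apply Submodule.eq_top_of_finrank_eq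
    rw [← Matrix.rank, hr, Module.finrank_fintype_fun_eq_card]
  obtain ⟨b, hb⟩ := LinearMap.range_eq_top.1 hsurj fun _ => 1
  have hb' : ∀ j ∈ T, z j ⬝ᵥ b = 1 := fun j hj => congrFun hb ⟨j, hj⟩
  obtain ⟨t, ht, hpt⟩ := exists_pos_forall_pos_add_mul
    (fun j : {j // j ∉ T} => z j ⬝ᵥ a) (fun j => z j ⬝ᵥ b)
    fun j => lt_of_le_of_ne (ha j) (Ne.symm (by simpa [hT] using j.2))
  refine ⟨a + t • b, fun j => ?_⟩
  rw [dotProduct_add, dotProduct_smul, smul_eq_mul]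
  by_cases hj : j ∈ T
  · rw [hb' j hj, (Finset.mem_filter.1 hj).2]; simpa
  · exact hpt ⟨j, hj⟩

end InGeneralPosition

/-- The points of `ℝ^m` formed by the first `m` coordinates of the columns of a matrix with
rows `v`. -/
def truncatedColumns {n m : ℕ} (hm : m ≤ n) (v : Fin n → Fin n → ℝ) : Fin n → Fin m → ℝ :=
  fun j i => v (Fin.castLE hm i) j

lemma mem_firstSpan_iff {Ω : Type*} {n m : ℕ} (hm : m ≤ n) (v : Fin n → Ω → Fin n → ℝ) (ω : Ω)
    (x : Fin n → ℝ) :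
    x ∈ firstSpan v m ω ↔
      ∃ a : Fin m → ℝ, ∀ j, truncatedColumns hm (fun i => v i ω) j ⬝ᵥ a = x j := by
  have : {x | ∃ i : Fin n, (i : ℕ) < m ∧ x = v i ω} =
      Set.range fun i : Fin m => v (Fin.castLE hm i) ω := by
    ext x
    constructor
    · rintro ⟨i, hi, rfl⟩
      exact ⟨⟨i, hi⟩, rfl⟩
    · rintro ⟨i, rfl⟩
      exact ⟨_, i.2, rfl⟩
  rw [firstSpan, this, Submodule.mem_span_range_iff_exists_fun]
  simp [funext_iff, truncatedColumns, dotProduct, mul_comm]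

lemma containsPositive_firstSpan_iff {Ω : Type*} {n m : ℕ} (hn : 1 ≤ n) (hm : m ≤ n)
    (v : Fin n → Ω → Fin n → ℝ) (ω : Ω)
    (h : InGeneralPosition (truncatedColumns hm fun i => v i ω)) :
    ContainsPositive (firstSpan v m ω) ↔
      InOpenHalfSpace (truncatedColumns hm fun i => v i ω) := by
  constructor
  · rintro ⟨x, hx, h0, hpos⟩
    obtain ⟨a, ha⟩ := (mem_firstSpan_iff hm v ω x).1 hx
    exact h.inOpenHalfSpace_of_nonneg (a := a) (by simpa only [ha] using h0)
      (by simpa only [ha] using hpos)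
  · rintro ⟨a, ha⟩
    exact ⟨_, (mem_firstSpan_iff hm v ω _).2 ⟨a, fun j => rfl⟩, fun j => (ha j).le, ⟨0, hn⟩, ha _⟩

lemma firstSpan_mono {Ω : Type*} {n : ℕ} (v : Fin n → Ω → Fin n → ℝ) (ω : Ω) :
    Monotone fun m => firstSpan v m ω := fun _ _ hm =>
  Submodule.span_mono fun _ ⟨i, hi, hx⟩ => ⟨i, hi.trans_le hm, hx⟩

lemma ContainsPositive.mono {n : ℕ} {V W : Submodule ℝ (Fin n → ℝ)} (h : ContainsPositive V)
    (hVW : V ≤ W) : ContainsPositive W :=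
  let ⟨x, hx, hp⟩ := h
  ⟨x, hVW hx, hp⟩

/-! ### Random points in general position -/

/-- A law on `ℝ^d` that is symmetric with respect to the origin and does not charge any proper
linear subspace. -/
structure IsSymmetricNondegenerate {d : ℕ} (μ : Measure (Fin d → ℝ)) : Prop where
  map_neg : μ.map (fun x => -x) = μ
  measure_submodule : ∀ W : Submodule ℝ (Fin d → ℝ), W ≠ ⊤ → μ W = 0

namespace IsSymmetricNondegenerate

/-- The reason why the distribution of the truncated columns need not be computed: having no mass
on proper subspaces passes to images under surjective linear maps. -/
lemma map {d m : ℕ} {μ : Measure (Fin d → ℝ)} (h : IsSymmetricNondegenerate μ)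
    (L : (Fin d → ℝ) →ₗ[ℝ] Fin m → ℝ) (hL : Function.Surjective L) :
    IsSymmetricNondegenerate (μ.map L) := by
  have hLm : Measurable L := L.continuous_of_finiteDimensional.measurable
  refine ⟨?_, fun W hW => ?_⟩
  · conv_rhs => rw [← h.map_neg]
    rw [Measure.map_map measurable_neg hLm, Measure.map_map hLm measurable_neg]
    congr 1
    ext x : 1
    simp
  · rw [Measure.map_apply hLm W.closed_of_finiteDimensional.measurableSet]
    refine h.measure_submodule (W.comap L) fun htop => hW ?_
    rw [← Submodule.map_comap_eq_of_surjective hL W, htop, Submodule.map_top,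
      LinearMap.range_eq_top.2 hL]

lemma of_absolutelyContinuous {d : ℕ} {μ : Measure (Fin d → ℝ)}
    (hneg : μ.map (fun x => -x) = μ) (hac : μ ≪ volume) : IsSymmetricNondegenerate μ :=
  ⟨hneg, fun W hW => hac (Measure.addHaar_submodule _ W hW)⟩

end IsSymmetricNondegenerate

lemma HasSymmetricDensity.isSymmetricNondegenerate {Ω : Type*} [MeasurableSpace Ω] {P : Measure Ω}
    {d : ℕ} {X : Ω → Fin d → ℝ} (h : HasSymmetricDensity P X) :
    IsSymmetricNondegenerate (P.map X) := by
  obtain ⟨-, f, hf, hsymm, hmap⟩ := h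
  rw [hmap]
  refine .of_absolutelyContinuous ?_ (withDensity_absolutelyContinuous _ _)
  ext s hs
  rw [Measure.map_apply measurable_neg hs, withDensity_apply _ (measurable_neg hs),
    withDensity_apply _ hs]
  have := (Measure.measurePreserving_neg (volume : Measure (Fin d → ℝ))).setLIntegral_comp_preimage
    hs hf
  simpa only [hsymm] using this

lemma pi_absolutelyContinuous {α : Type*} [MeasurableSpace α] {k : ℕ}
    {μ ν : Fin k → Measure α} [∀ i, SigmaFinite (μ i)] [∀ i, SigmaFinite (ν i)]
    (h : ∀ i, μ i ≪ ν i) : Measure.pi μ ≪ Measure.pi ν := by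
  induction k with
  | zero =>
    rw [Measure.pi_of_empty, Measure.pi_of_empty]
  | succ k ih =>
    rw [← ((measurePreserving_piFinSuccAbove μ 0).symm _).map_eq,
      ← ((measurePreserving_piFinSuccAbove ν 0).symm _).map_eq]
    exact ((h 0).prod (ih fun j => h _)).map (MeasurableEquiv.measurable _)

lemma isSymmetricNondegenerate_pi_gaussianReal (d : ℕ) :
    IsSymmetricNondegenerate (Measure.pi fun _ : Fin d => gaussianReal 0 1) := by
  refine .of_absolutelyContinuous ?_
    (pi_absolutelyContinuous fun _ => gaussianReal_absolutelyContinuous 0 one_ne_zero)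
  have := Measure.pi_map_pi (μ := fun _ : Fin d => gaussianReal 0 1) (f := fun _ x => -x)
    (hμ := fun _ => by rw [gaussianReal_map_neg]; infer_instance)
    fun _ => measurable_neg.aemeasurable
  simp only [gaussianReal_map_neg, neg_zero] at this
  exact this

/-- Independent points, at most as many as the dimension, none of whose laws charges a proper
subspace, are almost surely linearly independent: each new point avoids the span of the others. -/
lemma ae_linearIndependent_pi {d k : ℕ} (hk : k ≤ d) (μ : Fin k → Measure (Fin d → ℝ))
    [∀ i, IsProbabilityMeasure (μ i)] (h : ∀ i, IsSymmetricNondegenerate (μ i)) :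
    ∀ᵐ z ∂Measure.pi μ, LinearIndependent ℝ z := by
  induction k with
  | zero => exact Filter.Eventually.of_forall fun z => linearIndependent_empty_type
  | succ k ih =>
    have hmp := (measurePreserving_piFinSuccAbove μ 0).symm
    rw [← hmp.map_eq, ae_map_iff (MeasurableEquiv.measurable _).aemeasurable
      isOpen_setOfPred_linearIndependent.measurableSet]
    have hmeas : MeasurableSet {p : (Fin d → ℝ) × (Fin k → Fin d → ℝ) |
        LinearIndependent ℝ ((MeasurableEquiv.piFinSuccAbove (fun _ => Fin d → ℝ) 0).symm p)} :=
      (MeasurableEquiv.measurable _) isOpen_setOfPred_linearIndependent.measurableSet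
    -- Fubini with the last `k` points fixed first; linear independence is an open condition, hence
    -- measurable
    rw [← Measure.prod_swap, ae_map_iff measurable_swap.aemeasurable hmeas]
    refine (Measure.ae_prod_iff_ae_ae (measurable_swap hmeas)).2 ?_
    filter_upwards [ih (by omega) (fun j => μ (Fin.succAbove 0 j)) fun j => h _] with z hz
    have hspan : Submodule.span ℝ (Set.range z) ≠ ⊤ := by
      intro htop
      have := finrank_span_eq_card hz
      rw [htop, finrank_top, Module.finrank_fin_fun, Fintype.card_fin] at this
      omega
    have hnull := (h 0).measure_submodule _ hspan
    filter_upwards [measure_eq_zero_iff_ae_notMem.1 hnull] with x hx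
    have : (MeasurableEquiv.piFinSuccAbove (fun _ : Fin (k + 1) => Fin d → ℝ) 0).symm
        (Prod.swap (z, x)) = Fin.cons x z := by
      simp [MeasurableEquiv.piFinSuccAbove, Fin.insertNthEquiv]
    rw [this, linearIndependent_finCons]
    exact ⟨hz, hx⟩

section

variable {Ω : Type*} [MeasurableSpace Ω] {P : Measure Ω} {n d : ℕ}
  {z : Fin n → Ω → Fin d → ℝ}

lemma ae_inGeneralPosition [IsProbabilityMeasure P] (hz : ∀ j, Measurable (z j))
    (hindep : iIndepFun z P)
    (hlaw : ∀ j, IsSymmetricNondegenerate (P.map (z j))) :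
    ∀ᵐ ω ∂P, InGeneralPosition fun j => z j ω := by
  refine ae_all_iff.2 fun S => ?_
  by_cases hS : S.card ≤ d
  swap
  · exact Filter.Eventually.of_forall fun ω h => absurd h hS
  let e : Fin S.card ≃ S := S.equivFin.symm
  have hmap := iIndepFun.map_fun_eq_pi_map (fun i => (hz (e i)).aemeasurable)
    (hindep.precomp (Subtype.val_injective.comp e.injective))
  have : ∀ i, IsProbabilityMeasure (P.map (z (e i))) := fun i =>
    Measure.isProbabilityMeasure_map (hz _).aemeasurable
  have hae := ae_linearIndependent_pi hS (fun i => P.map (z (e i))) fun i => hlaw _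
  change P.map (fun ω i => z (e i) ω) = _ at hmap
  rw [← hmap] at hae
  filter_upwards [ae_of_ae_map (measurable_pi_lambda _ fun i => hz _).aemeasurable hae] with ω hω _
  exact (linearIndependent_equiv e).1 hω

/-- Reflecting some of the points in the origin does not change the probability of lying in an open
half-space. -/
lemma measure_inOpenHalfSpace_boolSign (hz : ∀ j, Measurable (z j)) (hindep : iIndepFun z P)
    (hlaw : ∀ j, IsSymmetricNondegenerate (P.map (z j))) (ε : Fin n → Bool) :
    P {ω | InOpenHalfSpace fun j => boolSign (ε j) • z j ω} =
      P {ω | InOpenHalfSpace fun j => z j ω} := by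
  have hzε : ∀ j, Measurable fun ω => boolSign (ε j) • z j ω := fun j =>
    (measurable_const_smul (boolSign (ε j))).comp (hz j)
  have h1 := hindep.map_fun_eq_pi_map (fun j => (hz j).aemeasurable)
  have h2 := (hindep.comp (fun j x => boolSign (ε j) • x)
    fun j => measurable_const_smul _).map_fun_eq_pi_map (fun j => (hzε j).aemeasurable)
  have h3 : ∀ j, P.map (fun ω => boolSign (ε j) • z j ω) = P.map (z j) := by
    intro j
    cases ε j
    · conv_rhs => rw [← (hlaw j).map_neg, Measure.map_map measurable_neg (hz j)]
      simp [Function.comp_def]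
    · simp
  have h4 : P.map (fun ω j => boolSign (ε j) • z j ω) = P.map fun ω j => z j ω := by
    rw [h1]
    refine h2.trans ?_
    congr 1
    ext1 j
    exact h3 j
  have hs := (isOpen_inOpenHalfSpace n d).measurableSet
  have := congrArg (fun ν => ν {z | InOpenHalfSpace z}) h4
  rwa [Measure.map_apply (measurable_pi_lambda _ hzε) hs,
    Measure.map_apply (measurable_pi_lambda _ hz) hs] at this

/-- Wendel's theorem: the expected number of reflections of the points that bring them into a common
open half-space is the constant `cellCount n d`, and all `2 ^ n` reflections are equally likely to
do so. -/
theorem measureReal_inOpenHalfSpace [IsProbabilityMeasure P] (hz : ∀ j, Measurable (z j))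
    (hindep : iIndepFun z P) (hlaw : ∀ j, IsSymmetricNondegenerate (P.map (z j))) :
    P.real {ω | InOpenHalfSpace fun j => z j ω} = cellCount n d / 2 ^ n := by
  classical
  have hmeas : ∀ ε : Fin n → Bool,
      MeasurableSet {ω | InOpenHalfSpace fun j => boolSign (ε j) • z j ω} := fun ε =>
    (measurable_pi_lambda (fun ω j => boolSign (ε j) • z j ω) fun j =>
      (measurable_const_smul (boolSign (ε j))).comp (hz j))
      (isOpen_inOpenHalfSpace n d).measurableSet
  have h1 : ∑ ε : Fin n → Bool, P {ω | InOpenHalfSpace fun j => boolSign (ε j) • z j ω} =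
      cellCount n d := by
    simp_rw [← lintegral_indicator_one (hmeas _)]
    rw [← lintegral_finsetSum _ fun ε _ => measurable_one.indicator (hmeas ε)]
    have : ∀ᵐ ω ∂P, ∑ ε : Fin n → Bool,
        {ω | InOpenHalfSpace fun j => boolSign (ε j) • z j ω}.indicator (1 : Ω → ENNReal) ω =
          cellCount n d := by
      filter_upwards [ae_inGeneralPosition hz hindep hlaw] with ω hω
      rw [← hω.card_inOpenHalfSpace, Finset.card_filter]
      simp [Set.indicator_apply]
    rw [lintegral_congr_ae this]
    simp
  simp only [measure_inOpenHalfSpace_boolSign hz hindep hlaw, Finset.sum_const, Finset.card_univ,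
    Fintype.card_fun, Fintype.card_bool, Fintype.card_fin, nsmul_eq_mul] at h1
  have := congrArg ENNReal.toReal h1
  rw [eq_div_iff (by positivity), mul_comm]
  simpa [Measure.real] using this

end

/-! ### The first span containing a positive vector -/

lemma setOf_hullMissesOrigin {Ω : Type*} {n d : ℕ} (z : Fin n → Ω → Fin d → ℝ) :
    hullMissesOrigin z = {ω | InOpenHalfSpace fun j => z j ω} :=
  Set.ext fun _ => zero_notMem_convexHull_iff _

lemma hullMissProb_eq (n d : ℕ) : hullMissProb n d = cellCount n d / 2 ^ n := by
  rw [hullMissProb, setOf_hullMissesOrigin]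
  have hind := iIndepFun_pi (μ := fun _ : Fin n => Measure.pi fun _ : Fin d => gaussianReal 0 1)
    (X := fun _ x => x) fun _ => measurable_id.aemeasurable
  refine measureReal_inOpenHalfSpace (fun j => measurable_pi_apply j) hind fun j => ?_
  rw [(measurePreserving_eval (fun _ : Fin n => Measure.pi fun _ : Fin d => gaussianReal 0 1)
    j).map_eq]
  exact isSymmetricNondegenerate_pi_gaussianReal d

lemma hullMissProb_sub {n m : ℕ} (hn : 1 ≤ n) (hm : 1 ≤ m) :
    hullMissProb n m - hullMissProb n (m - 1) =
      (1 / 2 ^ (n - 1) : ℝ) * ((n - 1).choose (m - 1) : ℝ) := by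
  obtain ⟨n, rfl⟩ := Nat.exists_eq_add_of_le' hn
  obtain ⟨m, rfl⟩ := Nat.exists_eq_add_of_le' hm
  rw [hullMissProb_eq, hullMissProb_eq, Nat.add_sub_cancel, Nat.add_sub_cancel,
    cellCount_succ_succ, pow_succ]
  push_cast
  field_simp
  ring

lemma not_containsPositive_firstSpan_zero
    {Ω : Type*} {n : ℕ} (v : Fin n → Ω → Fin n → ℝ) (ω : Ω) :
    ¬ ContainsPositive (firstSpan v 0 ω) := by
  rintro ⟨x, hx, -, i, hi⟩
  simp [firstSpan] at hx
  simp [hx] at hi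

lemma firstPositiveIndex_eq_iff {Ω : Type*} {n : ℕ} {v : Fin n → Ω → Fin n → ℝ} {ω : Ω}
    (h : ContainsPositive (firstSpan v n ω)) {k : ℕ}
    (hk : 1 ≤ k) :
    firstPositiveIndex v ω = k ↔
      ContainsPositive (firstSpan v k ω) ∧ ¬ ContainsPositive (firstSpan v (k - 1) ω) := by
  have hmem : ContainsPositive (firstSpan v (firstPositiveIndex v ω) ω) :=
    Nat.sInf_mem (s := {m | ContainsPositive (firstSpan v m ω)}) ⟨n, h⟩
  have hle : ∀ m, ContainsPositive (firstSpan v m ω) → firstPositiveIndex v ω ≤ m :=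
    fun m hm => Nat.sInf_le hm
  constructor
  · rintro rfl
    exact ⟨hmem, fun h' => by have := hle _ h'; omega⟩
  · rintro ⟨h1, h2⟩
    refine le_antisymm (hle k h1) ?_
    by_contra! hlt
    exact h2 (hmem.mono (firstSpan_mono v ω (by omega)))

section

variable {Ω : Type*} [MeasurableSpace Ω] {P : Measure Ω} [IsProbabilityMeasure P] {n : ℕ}
  {v : Fin n → Ω → Fin n → ℝ}

/-- For `m ≤ n`, almost surely `V_m` contains a positive vector exactly when the truncated columns
lie in an open half-space of `ℝ^m`; this event has probability `p(n, m)`. -/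
lemma containsPositive_firstSpan_ae (hn : 1 ≤ n)
    (hv : IndepSymmetricPoints P (fun (j : Fin n) (ω : Ω) (i : Fin n) => v i ω j))
    {m : ℕ} (hm : m ≤ n) :
    NullMeasurableSet {ω | ContainsPositive (firstSpan v m ω)} P ∧
      P.real {ω | ContainsPositive (firstSpan v m ω)} = hullMissProb n m := by
  let L : (Fin n → ℝ) →ₗ[ℝ] Fin m → ℝ := LinearMap.funLeft ℝ ℝ (Fin.castLE hm)
  have hL : Function.Surjective L :=
    LinearMap.funLeft_surjective_of_injective ℝ ℝ _ (Fin.castLE_injective hm)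
  have hLm : Measurable L := L.continuous_of_finiteDimensional.measurable
  let z : Fin n → Ω → Fin m → ℝ := fun j ω => truncatedColumns hm (fun i => v i ω) j
  have hz : ∀ j, Measurable (z j) := fun j => hLm.comp (hv.density j).1
  have hindep : iIndepFun z P := hv.indep.comp (fun _ => L) fun _ => hLm
  have hlaw : ∀ j, IsSymmetricNondegenerate (P.map (z j)) := by
    intro j
    have := (hv.density j).isSymmetricNondegenerate.map L hL
    rwa [Measure.map_map hLm (hv.density j).1] at this
  have hae : {ω | ContainsPositive (firstSpan v m ω)} =ᵐ[P]
      {ω | InOpenHalfSpace fun j => z j ω} := by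
    filter_upwards [ae_inGeneralPosition hz hindep hlaw] with ω hω
    exact propext (containsPositive_firstSpan_iff hn hm v ω hω)
  have hmeas : MeasurableSet {ω | InOpenHalfSpace fun j => z j ω} :=
    (measurable_pi_lambda (fun ω j => z j ω) hz) (isOpen_inOpenHalfSpace n m).measurableSet
  refine ⟨hmeas.nullMeasurableSet.congr hae.symm, ?_⟩
  rw [measureReal_congr hae, measureReal_inOpenHalfSpace hz hindep hlaw, hullMissProb_eq]

lemma measureReal_containsPositive_diff (hn : 1 ≤ n)
    (hv : IndepSymmetricPoints P (fun (j : Fin n) (ω : Ω) (i : Fin n) => v i ω j))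
    {m : ℕ} (hm : m ≤ n) :
    P.real {ω | ContainsPositive (firstSpan v m ω) ∧
        ¬ ContainsPositive (firstSpan v (m - 1) ω)} =
      hullMissProb n m - hullMissProb n (m - 1) := by
  obtain ⟨-, h1⟩ := containsPositive_firstSpan_ae hn hv hm
  obtain ⟨h2, h3⟩ := containsPositive_firstSpan_ae hn hv ((Nat.sub_le m 1).trans hm)
  have hsub : {ω | ContainsPositive (firstSpan v (m - 1) ω)} ⊆
      {ω | ContainsPositive (firstSpan v m ω)} := fun ω hω =>
    ContainsPositive.mono hω (firstSpan_mono v ω (Nat.sub_le m 1))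
  rw [← h1, ← h3, measureReal_def, measureReal_def, measureReal_def,
    ← ENNReal.toReal_sub_of_le (measure_mono hsub) (measure_ne_top _ _),
    ← measure_sdiff hsub h2 (measure_ne_top _ _)]
  rfl

lemma ae_containsPositive_firstSpan_self (hn : 1 ≤ n)
    (hv : IndepSymmetricPoints P (fun (j : Fin n) (ω : Ω) (i : Fin n) => v i ω j)) :
    ∀ᵐ ω ∂P, ContainsPositive (firstSpan v n ω) := by
  obtain ⟨h1, h2⟩ := containsPositive_firstSpan_ae hn hv le_rfl
  have hone : hullMissProb n n = 1 := by
    obtain ⟨n, rfl⟩ := Nat.exists_eq_add_of_le' hn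
    rw [hullMissProb_eq, cellCount_self]
    push_cast
    exact div_self (by positivity)
  rw [hone, measureReal_def, ENNReal.toReal_eq_one_iff] at h2
  exact (prob_compl_eq_zero_iff₀ h1).2 h2

end

theorem mainTheorem7 {Ω : Type*} [MeasurableSpace Ω] (P : Measure Ω) [IsProbabilityMeasure P]
    (n : ℕ) (hn : 1 ≤ n) (v : Fin n → Ω → Fin n → ℝ)
    -- the columns of the random matrix with rows `v_1, …, v_n`
    (hv : IndepSymmetricPoints P (fun (j : Fin n) (ω : Ω) (i : Fin n) => v i ω j)) :
    -- `p(n, d)` is the probability for all admissible random points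
    (∀ (d : ℕ) {Ω' : Type*} [MeasurableSpace Ω'] (P' : Measure Ω') [IsProbabilityMeasure P']
        (z : Fin n → Ω' → Fin d → ℝ), IndepSymmetricPoints P' z →
        P'.real (hullMissesOrigin z) = hullMissProb n d) ∧
    (∀ m : ℕ, 1 ≤ m → m ≤ n →
      P.real {ω | ContainsPositive (firstSpan v m ω) ∧
          ¬ ContainsPositive (firstSpan v (m - 1) ω)} =
        hullMissProb n m - hullMissProb n (m - 1) ∧
      hullMissProb n m - hullMissProb n (m - 1) =
        (1 / 2 ^ (n - 1) : ℝ) * ((n - 1).choose (m - 1) : ℝ)) ∧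
    (∀ᵐ ω ∂P, firstPositiveIndex v ω ≤ n ∧
      IsLeast {m | ContainsPositive (firstSpan v m ω)} (firstPositiveIndex v ω)) ∧
    HasLaw (firstPositiveIndex v)
      ((ProbabilityTheory.binomial (n - 1) fairCoin).map fun k => 1 + k) P := by
  have hself := ae_containsPositive_firstSpan_self hn hv
  have hfiber : ∀ k, 1 ≤ k → {ω | firstPositiveIndex v ω = k} =ᵐ[P]
      {ω | ContainsPositive (firstSpan v k ω) ∧ ¬ ContainsPositive (firstSpan v (k - 1) ω)} := by
    intro k hk
    filter_upwards [hself] with ω hω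
    exact propext (firstPositiveIndex_eq_iff hω hk)
  -- the infimum is attained, since almost surely `V_n` contains a positive vector; `V_0` does not
  have hrange : ∀ᵐ ω ∂P, 1 ≤ firstPositiveIndex v ω ∧ firstPositiveIndex v ω ≤ n ∧
      IsLeast {m | ContainsPositive (firstSpan v m ω)} (firstPositiveIndex v ω) := by
    filter_upwards [hself] with ω hω
    have hmem : ContainsPositive (firstSpan v (firstPositiveIndex v ω) ω) :=
      Nat.sInf_mem (s := {m | ContainsPositive (firstSpan v m ω)}) ⟨n, hω⟩
    refine ⟨?_, Nat.sInf_le hω, hmem, fun m hm => Nat.sInf_le hm⟩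
    by_contra! h0
    rw [Nat.lt_one_iff.1 h0] at hmem
    exact not_containsPositive_firstSpan_zero v ω hmem
  have hnull : ∀ k, ¬ (1 ≤ k ∧ k ≤ n) → {ω | firstPositiveIndex v ω = k} =ᵐ[P] (∅ : Set Ω) := by
    intro k hk
    filter_upwards [hrange] with ω hω
    exact eq_false fun h => hk ⟨h ▸ hω.1, h ▸ hω.2.1⟩
  -- the index need not be measurable, as it agrees with a measurable function only off a null set
  have hmeas : ∀ k, NullMeasurableSet {ω | firstPositiveIndex v ω = k} P := by
    intro k
    by_cases hk : 1 ≤ k ∧ k ≤ n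
    · refine NullMeasurableSet.congr ?_ (hfiber k hk.1).symm
      exact (containsPositive_firstSpan_ae hn hv hk.2).1.inter
        (containsPositive_firstSpan_ae hn hv ((Nat.sub_le k 1).trans hk.2)).1.compl
    · exact MeasurableSet.empty.nullMeasurableSet.congr (hnull k hk).symm
  have hX : AEMeasurable (firstPositiveIndex v) P := by
    refine NullMeasurable.aemeasurable fun s _ => ?_
    rw [← Set.biUnion_preimage_singleton]
    exact NullMeasurableSet.biUnion s.to_countable fun k _ => hmeas k
  refine ⟨fun d Ω' _ P' _ z hz => ?_, fun m hm hmn =>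
    ⟨measureReal_containsPositive_diff hn hv hmn, hullMissProb_sub hn hm⟩,
    hrange.mono fun ω h => h.2, hX, ?_⟩
  · rw [setOf_hullMissesOrigin, hullMissProb_eq]
    exact measureReal_inOpenHalfSpace (fun j => (hz.density j).1) hz.indep
      fun j => (hz.density j).isSymmetricNondegenerate
  · refine Measure.ext_of_singleton fun k => ?_
    rw [Measure.map_apply_of_aemeasurable hX (measurableSet_singleton k),
      Measure.map_apply (by fun_prop) (measurableSet_singleton k)]
    change P {ω | firstPositiveIndex v ω = k} = _
    rcases k with _ | k
    · rw [measure_congr (hnull 0 (by simp)), measure_empty]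
      have : (fun k => 1 + k) ⁻¹' {0} = (∅ : Set ℕ) := by ext; simp
      rw [this, measure_empty]
    · have : (fun k => 1 + k) ⁻¹' {k + 1} = ({k} : Set ℕ) := by
        ext; simp [add_comm]
      rw [this]
      by_cases hk : k + 1 ≤ n
      · rw [← ENNReal.toReal_eq_toReal_iff' (measure_ne_top _ _) (measure_ne_top _ _)]
        change P.real _ = (binomial (n - 1) fairCoin).real _
        rw [measureReal_congr (hfiber (k + 1) (by simp)),
          measureReal_containsPositive_diff hn hv hk, hullMissProb_sub hn (by simp),
          binomial_real_singleton, Nat.add_sub_cancel]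
        have h2 : (1 - 1 / 2 : ℝ) = 1 / 2 := by norm_num
        rw [show (fairCoin : ℝ) = 1 / 2 from rfl, h2, mul_assoc, ← pow_add,
          Nat.add_sub_cancel' (by omega), mul_comm, one_div_pow]
      · rw [measure_congr (hnull (k + 1) (by omega)), measure_empty, binomial_singleton,
          Nat.choose_eq_zero_of_lt (by omega)]
        simp
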